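/- For a positive integer $n$ and graphs $H$ and $F$, let $\mathrm{ex}(n, \{H, F\text{-ind}\})$ denote the maximum number of edges in a simple graph on $n$ vertices that has no subgraph isomorphic to $H$ and no induced subgraph isomorphic to $F$. Let $C_k$ be the cycle on $k$ vertices and $K_{1,t}$ the star with $t$ leaves. Theorem. For all integers $t \ge 3$ and $k \ge 3$ and every $n$, $$\mathrm{ex}(n, \{C_k, K_{1,t}\text{-ind}\}) \le \tfrac12 (k-2)(t-1)\,n,$$ and, for every such $t$ and $k$, equality holds for infinitely many values of $n$. -/

import Mathlib

namespace SimpleGraph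

open scoped Classical in
/-- The induced Turán number: the maximum number of edges of a graph on `n` vertices that has no
subgraph isomorphic to `H` and no induced subgraph isomorphic to `F` (it is `0` if there is no such
graph, which does not happen when both `H` and `F` have an edge). -/
noncomputable def inducedTuranNumber (n : ℕ) {V W : Type*} (H : SimpleGraph V)
    (F : SimpleGraph W) : ℕ :=
  (Finset.univ.filter fun G : SimpleGraph (Fin n) => ¬ H.IsContained G ∧ ¬ F.IsIndContained G).sup
    fun G => G.edgeFinset.card

end SimpleGraph

/-! Upper bound: a path with `k - 2` edges inside the neighbourhood of `x` closes up through `x` to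
a `C_k`. Repeatedly deleting the closed neighbourhood of an end of a longest path therefore yields
an independent set of at least `deg x / (k - 2)` neighbours, and at most `t - 1` are allowed. So
every degree is at most `(k - 2)(t - 1)`.

Sharpness: the Cayley graph of a free product of `t - 1` cyclic groups of order `k - 1` is a tree of
cliques `K_{k-1}`, with `t - 1` of them at each vertex. A finite quotient injective on words of
length at most `k` keeps the degrees, and its `k`-cycles lift to the free product, where a cycle
stays in one clique (`exists_le_card_of_steps`). -/

namespace SimpleGraph

/-! ### Upper bound: degrees -/

/-- If every path of `G` inside `S` has fewer than `m` edges, then `S` contains an independent set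
with at least `#S / m` vertices. -/
theorem exists_isIndepSet_of_path_length_lt {V : Type*} (G : SimpleGraph V) (m : ℕ)
    (S : Finset V)
    (h : ∀ (u v : V) (p : G.Walk u v), p.IsPath → (∀ x ∈ p.support, x ∈ S) → p.length < m) :
    ∃ T ⊆ S, G.IsIndepSet (T : Set V) ∧ S.card ≤ m * T.card := by
  classical
  induction S using Finset.strongInduction with
  | H S ih =>
  obtain rfl | ⟨x, hx⟩ := S.eq_empty_or_nonempty
  · exact ⟨∅, subset_rfl, by simp, by simp⟩
  let P : ℕ → Prop := fun l => ∃ (u v : V) (p : G.Walk u v),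
    p.IsPath ∧ (∀ x ∈ p.support, x ∈ S) ∧ p.length = l
  have hP0 : P 0 := ⟨x, x, .nil, by simp, by simpa using hx, rfl⟩
  obtain ⟨u, v, p, hp, hpS, hpl⟩ : P (Nat.findGreatest P m) :=
    Nat.findGreatest_spec (Nat.zero_le _) hP0
  have hmax : ∀ (u v : V) (q : G.Walk u v), q.IsPath → (∀ x ∈ q.support, x ∈ S) →
      q.length ≤ p.length := fun u v q hq hqS => by
    rw [hpl]
    exact Nat.le_findGreatest (h u v q hq hqS).le ⟨u, v, q, hq, hqS, rfl⟩
  have huS : u ∈ S := hpS u p.start_mem_support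
  -- As `p` is a longest path in `S`, the closed neighbourhood of its end `u` lies on `p`.
  set N := S.filter fun y => y = u ∨ G.Adj u y with hN
  have hNp : N ⊆ p.support.toFinset := by
    intro y hy
    rw [hN, Finset.mem_filter] at hy
    rw [List.mem_toFinset]
    by_contra hyp
    obtain ⟨hyS, rfl | hadj⟩ := hy
    · exact hyp p.start_mem_support
    have := hmax y v (.cons hadj.symm p) (hp.cons hyp) (by
      intro z hz
      rw [Walk.support_cons, List.mem_cons] at hz
      obtain rfl | hz := hz
      · exact hyS
      · exact hpS z hz)
    simp at this
  have hNm : N.card ≤ m := by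
    calc N.card ≤ p.support.toFinset.card := Finset.card_le_card hNp
      _ ≤ p.support.length := List.toFinset_card_le _
      _ = p.length + 1 := p.length_support
      _ ≤ m := h u v p hp hpS
  have huN : u ∈ N := by simp [hN, huS]
  obtain ⟨T, hTS, hT, hcard⟩ := ih (S \ N)
    (Finset.sdiff_ssubset (Finset.filter_subset _ _) ⟨u, huN⟩)
    fun a b q hq hqS => h a b q hq fun x hx => (Finset.mem_sdiff.1 (hqS x hx)).1
  have huT : u ∉ T := fun hu => (Finset.mem_sdiff.1 (hTS hu)).2 huN
  have hadj : ∀ y ∈ T, ¬ G.Adj u y := fun y hy hadj => by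
    have := Finset.mem_sdiff.1 (hTS hy)
    exact this.2 (by simp [hN, this.1, hadj])
  refine ⟨insert u T, Finset.insert_subset huS (hTS.trans Finset.sdiff_subset), ?_, ?_⟩
  · rw [Finset.coe_insert, isIndepSet_iff, Set.pairwise_insert]
    exact ⟨hT, fun y hy _ => ⟨hadj y hy, fun h => hadj y hy h.symm⟩⟩
  · rw [Finset.card_insert_of_notMem huT]
    have := Finset.card_sdiff_add_card_eq_card (Finset.filter_subset (fun y => y = u ∨ G.Adj u y) S)
    rw [← hN] at this
    linarith

/-- A path with `n + 1` edges in the neighbourhood of a vertex closes up to a cycle on `n + 3`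
vertices. -/
theorem cycleGraph_isContained_of_isPath {V : Type*} {G : SimpleGraph V} {n : ℕ} {x u v : V}
    (p : G.Walk u v) (hp : p.IsPath) (hx : ∀ y ∈ p.support, G.Adj x y) (hn : p.length = n + 1) :
    cycleGraph (n + 3) ⊑ G := by
  rw [cycleGraph_isContained_iff (by omega)]
  have hxp : x ∉ p.support := fun h => G.irrefl (hx x h)
  refine ⟨x, .cons (hx u p.start_mem_support) (p.concat (hx v p.end_mem_support).symm), ?_, ?_⟩
  · rw [Walk.cons_isCycle_iff]
    refine ⟨hp.concat hxp _, ?_⟩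
    rw [Walk.edges_concat, List.concat_eq_append, List.mem_append, List.mem_singleton]
    rintro (h | h)
    · exact hxp (p.fst_mem_support_of_mem_edges h)
    · have huv : u = v := by
        have := (hx u p.start_mem_support).ne
        have := (hx v p.end_mem_support).ne
        simp only [Sym2.eq_iff] at h
        tauto
      subst huv
      rw [Walk.isPath_iff_nil, ← Walk.length_eq_zero_iff] at hp
      omega
  · simp [hn]

/-- An independent set of `t` neighbours of a vertex gives an induced star with `t` leaves. -/
theorem star_isIndContained_of_isIndepSet {V : Type*} {G : SimpleGraph V} {t : ℕ} {x : V}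
    {T : Finset V} (hT : G.IsIndepSet (T : Set V)) (hx : ∀ y ∈ T, G.Adj x y) (ht : t ≤ T.card) :
    completeBipartiteGraph (Fin 1) (Fin t) ⊴ G := by
  obtain ⟨f⟩ : Nonempty (Fin t ↪ T) := by
    rw [Function.Embedding.nonempty_iff_card_le]
    simpa using ht
  refine ⟨⟨⟨Sum.elim (fun _ => x) fun i => (f i : V), ?_⟩, ?_⟩⟩
  · rintro (a | a) (b | b) h
    · simp [Subsingleton.elim a b]
    · exact absurd h (hx _ (f b).2).ne
    · exact absurd h (hx _ (f a).2).ne'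
    · simpa using f.injective (Subtype.ext h)
  · rintro (a | a) (b | b)
    · change G.Adj x x ↔ _
      simp
    · change G.Adj x (f b) ↔ _
      simpa using hx _ (f b).2
    · change G.Adj (f a) x ↔ _
      simpa using (hx _ (f a).2).symm
    · change G.Adj (f a) (f b) ↔ _
      simp only [completeBipartiteGraph_adj, Sum.isLeft_inr, Sum.isRight_inr, Bool.false_eq_true,
        and_true, and_false, or_self, iff_false]
      exact fun h => hT (f a).2 (f b).2 h.ne h

theorem degree_le_of_free {V : Type*} [Fintype V] {G : SimpleGraph V}
    [DecidableRel G.Adj] {t k : ℕ} (ht : 3 ≤ t) (hk : 3 ≤ k) (hC : ¬ cycleGraph k ⊑ G)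
    (hK : ¬ completeBipartiteGraph (Fin 1) (Fin t) ⊴ G) (x : V) :
    G.degree x ≤ (k - 2) * (t - 1) := by
  obtain ⟨T, hTN, hT, hcard⟩ := G.exists_isIndepSet_of_path_length_lt (k - 2) (G.neighborFinset x)
    fun u v p hp hpx => by
      by_contra! hlen
      obtain ⟨n, rfl⟩ := Nat.exists_eq_add_of_le' hk
      -- A path that is too long is cut to its first `n + 1 = k - 2` edges.
      refine hC (cycleGraph_isContained_of_isPath (x := x) (p.take (n + 1)) (hp.take _) ?_ ?_)
      · intro y hy
        simpa using hpx y ((p.isSubwalk_take (n + 1)).support_subset hy)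
      · rw [Walk.take_length]
        omega
  rw [card_neighborFinset_eq_degree] at hcard
  refine hcard.trans (Nat.mul_le_mul_left _ ?_)
  by_contra! h
  exact hK (star_isIndContained_of_isIndepSet hT (fun y hy => by simpa using hTN hy)
    (by omega))

theorem two_mul_card_edgeFinset_le_of_free {V : Type*} [Fintype V] {G : SimpleGraph V}
    [DecidableRel G.Adj] {t k : ℕ} (ht : 3 ≤ t) (hk : 3 ≤ k) (hC : ¬ cycleGraph k ⊑ G)
    (hK : ¬ completeBipartiteGraph (Fin 1) (Fin t) ⊴ G) :
    2 * G.edgeFinset.card ≤ (k - 2) * (t - 1) * Fintype.card V := by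
  rw [← sum_degrees_eq_twice_card_edges, mul_comm _ (Fintype.card V)]
  exact Finset.sum_le_card_nsmul _ _ _ fun x _ => degree_le_of_free ht hk hC hK x

end SimpleGraph

/-! ### Cycles in the Cayley graph of a free product -/

namespace Monoid.CoprodI.Word

variable {ι : Type*} {A : ι → Type*} [∀ i, Group (A i)] [DecidableEq ι] [∀ i, DecidableEq (A i)]

omit [DecidableEq ι] in
theorem length_rcons {i : ι} (p : Pair A i) :
    (rcons p).toList.length = p.tail.toList.length + if p.head = 1 then 0 else 1 := by
  unfold rcons
  split_ifs <;> simp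

theorem rcons_equivPair (i : ι) (w : Word A) : rcons (equivPair i w) = w :=
  (equivPair i).symm_apply_apply w

theorem equivPair_of_smul_tail {i : ι} (a : A i) (w : Word A) :
    (equivPair i (of a • w)).tail = (equivPair i w).tail := by
  rw [equivPair_smul_same]

theorem length_equivPair_tail_le (i : ι) (w : Word A) :
    (equivPair i w).tail.toList.length ≤ w.toList.length := by
  conv_rhs => rw [← rcons_equivPair i w, length_rcons]
  omega

theorem length_of_smul_le {i : ι} (a : A i) (w : Word A) :
    (of a • w).toList.length ≤ w.toList.length + 1 := by
  rw [of_smul_def, length_rcons]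
  have := length_equivPair_tail_le i w
  dsimp only
  split_ifs <;> omega

theorem length_of_smul_of_fstIdx_ne {i : ι} {a : A i} (ha : a ≠ 1) {w : Word A}
    (hw : w.fstIdx ≠ some i) : (of a • w).toList.length = w.toList.length + 1 := by
  rw [← cons_eq_smul (h1 := hw) (h2 := ha)]
  simp

theorem fstIdx_eq_and_length_of_ne_equivPair_tail {i : ι} {w : Word A}
    (hw : w ≠ (equivPair i w).tail) :
    w.fstIdx = some i ∧ w.toList.length = (equivPair i w).tail.toList.length + 1 := by
  have h1 : (equivPair i w).head ≠ 1 := by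
    intro h
    apply hw
    conv_lhs => rw [← rcons_equivPair i w]
    simp [rcons, h]
  constructor
  · conv_lhs => rw [← rcons_equivPair i w]
    simp [rcons, h1]
  · conv_lhs => rw [← rcons_equivPair i w, length_rcons]
    simp [h1]

/-- `v` and `w` differ by left multiplication with a non-trivial element of one of the factors. -/
def Step (v w : Word A) : Prop := ∃ (i : ι) (a : A i), a ≠ 1 ∧ w = of a • v

theorem Step.symm {v w : Word A} (h : Step v w) : Step w v := by
  obtain ⟨i, a, ha, rfl⟩ := h
  exact ⟨i, a⁻¹, inv_ne_one.2 ha, by rw [map_inv, inv_smul_smul]⟩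

/-- Multiplying by a letter from a factor other than that of the first letter lengthens the word. -/
theorem Step.exists_fstIdx {v w : Word A} (h : Step v w)
    (hl : w.toList.length ≤ v.toList.length) :
    ∃ i, v.fstIdx = some i ∧ (equivPair i w).tail = (equivPair i v).tail := by
  obtain ⟨i, a, ha, rfl⟩ := h
  refine ⟨i, ?_, equivPair_of_smul_tail a v⟩
  by_contra hv
  rw [length_of_smul_of_fstIdx_ne ha hv] at hl
  omega

/-- A walk which starts in the coset of a factor, stays away from the shortest word of that coset
and never gets longer than the other words of the coset, stays in the coset. -/
theorem equivPair_tail_eq_of_steps {i : ι} {p : Word A} {V : ℕ → Word A} {N : ℕ}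
    (h0 : (equivPair i (V 0)).tail = p) (hstep : ∀ j < N, Step (V j) (V (j + 1)))
    (hlen : ∀ j ≤ N, (V j).toList.length ≤ p.toList.length + 1) (hp : ∀ j < N, V j ≠ p) :
    ∀ j ≤ N, (equivPair i (V j)).tail = p := by
  intro j
  induction j with
  | zero => exact fun _ => h0
  | succ j ih =>
    intro hj
    have ih := ih (by omega)
    obtain ⟨hfst, hl⟩ := fstIdx_eq_and_length_of_ne_equivPair_tail (i := i) (w := V j)
      (by rw [ih]; exact hp j hj)
    obtain ⟨i', hi', ht⟩ := (hstep j hj).exists_fstIdx (by rw [hl, ih]; exact hlen _ hj)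
    obtain rfl : i = i' := by rw [hfst] at hi'; exact Option.some.inj hi'
    rw [ht, ih]

/-- In the Cayley graph of a free product with respect to its factors, a cycle stays within a coset
of one factor. -/
theorem exists_le_card_of_steps [∀ i, Finite (A i)] {k : ℕ} (hk : 2 ≤ k) {W : ℕ → Word A}
    (hW0 : W 0 = empty) (hWk : W k = empty) (hinj : ∀ a < k, ∀ b < k, W a = W b → a = b)
    (hstep : ∀ j < k, Step (W j) (W (j + 1))) : ∃ i, k ≤ Nat.card (A i) := by
  -- `W m` is a longest word on the cycle; `p` below is the shortest word of the coset in which the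
  -- cycle leaves it.
  obtain ⟨m, hmk, hmax⟩ := (Finset.range (k + 1)).exists_max_image
    (fun j => (W j).toList.length) ⟨0, by simp⟩
  simp only [Finset.mem_range, Nat.lt_succ_iff] at hmk hmax
  have hm : W m ≠ empty := by
    intro h
    have h1 := hmax 1 (by omega)
    rw [h] at h1
    have h2 : W 1 = empty := Word.ext (List.length_eq_zero_iff.1 (by simpa [empty] using h1))
    exact absurd (hinj 1 (by omega) 0 (by omega) (h2.trans hW0.symm)) (by omega)
  have hmk' : m < k := lt_of_le_of_ne hmk fun h => hm (h ▸ hWk)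
  have hm0 : m ≠ 0 := fun h => hm (h ▸ hW0)
  obtain ⟨i, hi, -⟩ := (hstep m hmk').exists_fstIdx (hmax _ (by omega))
  set p := (equivPair i (W m)).tail with hp
  have hpm : W m ≠ p := fun h => (equivPair i (W m)).fstIdx_ne (by rw [← hp, ← h, hi])
  have hml := (fstIdx_eq_and_length_of_ne_equivPair_tail hpm).2
  rw [← hp] at hml
  rw [hml] at hmax
  have hempty : (equivPair i empty).tail = p → p = empty := fun h => by
    rw [← h, equivPair_eq_of_fstIdx_ne (by simp [fstIdx, empty])]
  have hfwd : ∀ j, m + j ≤ k → (∀ l < j, W (m + l) ≠ p) → (equivPair i (W (m + j))).tail = p :=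
    fun j hj h => equivPair_tail_eq_of_steps (V := fun l => W (m + l)) (N := j) hp.symm
      (fun l hl => hstep (m + l) (by omega)) (fun l hl => hmax _ (by omega)) h j le_rfl
  have hbwd : ∀ j ≤ m, (∀ l < j, W (m - l) ≠ p) → (equivPair i (W (m - j))).tail = p :=
    fun j hj h => equivPair_tail_eq_of_steps (V := fun l => W (m - l)) (N := j) hp.symm
      (fun l hl => by
        have := (hstep (m - (l + 1)) (by omega)).symm
        rwa [show m - (l + 1) + 1 = m - l by omega] at this)
      (fun l hl => hmax _ (by omega)) h j le_rfl
  -- The cycle can leave the coset only through `p`, which it meets at most once. If it left on one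
  -- side of `m`, the other side would stay in the coset up to `empty`, forcing `p = empty` and a
  -- second visit to `p`.
  have hall : ∀ j < k, (equivPair i (W j)).tail = p := by
    intro j hj
    by_contra hne
    obtain hjm | hjm := le_total m j
    · obtain ⟨d, rfl⟩ := Nat.exists_eq_add_of_le hjm
      obtain ⟨l, hl, hlp⟩ : ∃ l < d, W (m + l) = p := by
        by_contra! h
        exact hne (hfwd d hj.le h)
      have h0 := hbwd m le_rfl fun l' hl' h => by
        have := hinj _ (by omega) _ (by omega) (h.trans hlp.symm)
        obtain rfl : l = 0 := by omega
        exact hpm hlp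
      rw [Nat.sub_self, hW0] at h0
      have := hinj 0 (by omega) _ (by omega) ((hW0.trans (hempty h0).symm).trans hlp.symm)
      omega
    · obtain ⟨l, hl, hlp⟩ : ∃ l < m - j, W (m - l) = p := by
        by_contra! h
        have := hbwd (m - j) (by omega) h
        rw [Nat.sub_sub_self hjm] at this
        exact hne this
      have h0 := hfwd (k - m) (by omega) fun l' hl' h => by
        have := hinj _ (by omega) _ (by omega) (h.trans hlp.symm)
        obtain rfl : l = 0 := by omega
        exact hpm hlp
      rw [Nat.add_sub_cancel' hmk, hWk] at h0
      have := hinj 0 (by omega) _ (by omega) ((hW0.trans (hempty h0).symm).trans hlp.symm)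
      omega
  refine ⟨i, ?_⟩
  have := Nat.card_le_card_of_injective (fun j : Fin k => (equivPair i (W j)).head) ?_
  · simpa using this
  · intro a b hab
    refine Fin.ext (hinj a a.2 b b.2 ((equivPair i).injective ?_))
    exact Pair.ext hab ((hall a a.2).trans (hall b b.2).symm)

/-! ### A finite quotient injective on short words -/

section Truncation

variable (A) (L : ℕ)

/-- The words with at most `L` letters. -/
abbrev Ball : Type _ := {w : Word A // w.toList.length ≤ L}

instance [Finite ι] [∀ i, Finite (A i)] : Finite (Ball A L) :=
  have := (List.finite_length_le (Σ i, A i) L).to_subtype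
  Finite.of_injective (β := {l : List (Σ i, A i) | l.length ≤ L}) (fun w => ⟨w.1.toList, w.2⟩)
    fun _ _ h => Subtype.ext (Word.ext (congrArg Subtype.val h))

variable {A L} in
open scoped Classical in
/-- Left multiplication with an element of a factor on those of its cosets that consist of words of
length at most `L`, and the identity elsewhere. -/
noncomputable def truncatedSMul {i : ι} (a : A i) (w : Ball A L) : Ball A L :=
  if h : ∀ b : A i, (of b • w.1).toList.length ≤ L then ⟨of a • w.1, h a⟩ else w

variable {A L} in
theorem truncatedSMul_of_forall {i : ι} (a : A i) {w : Ball A L}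
    (h : ∀ b : A i, (of b • w.1).toList.length ≤ L) : truncatedSMul a w = ⟨of a • w.1, h a⟩ :=
  dif_pos h

variable {A L} in
theorem truncatedSMul_of_not_forall {i : ι} (a : A i) {w : Ball A L}
    (h : ¬ ∀ b : A i, (of b • w.1).toList.length ≤ L) : truncatedSMul a w = w :=
  dif_neg h

/-- `truncatedSMul` as an action of a factor on the words of length at most `L`. -/
noncomputable def truncatedFactorHom (i : ι) : A i →* Function.End (Ball A L) where
  toFun a := truncatedSMul a
  map_one' := by
    funext w
    change truncatedSMul 1 w = w
    unfold truncatedSMul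
    split_ifs <;> simp
  map_mul' a b := by
    funext w
    change truncatedSMul (a * b) w = truncatedSMul a (truncatedSMul b w)
    -- The condition depends only on the coset of `w`, so all three multiplications take the same
    -- branch.
    by_cases h : ∀ c : A i, (of c • w.1).toList.length ≤ L
    · have h' : ∀ c : A i, (of c • of b • w.1).toList.length ≤ L := fun c => by
        rw [← mul_smul, ← map_mul]
        exact h _
      rw [truncatedSMul_of_forall _ h, truncatedSMul_of_forall b h,
        truncatedSMul_of_forall (w := ⟨_, h b⟩) a h']
      simp only [map_mul, mul_smul]
    · rw [truncatedSMul_of_not_forall _ h, truncatedSMul_of_not_forall b h,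
        truncatedSMul_of_not_forall a h]

/-- The truncated action of a free product on its words of length at most `L`. -/
noncomputable def truncatedHom : CoprodI A →* Equiv.Perm (Ball A L) :=
  lift fun i => (truncatedFactorHom A L i).toHomPerm

variable {A L}

/-- Built up letter by letter from `empty`, `w` never meets a truncated coset, since a factor adds
at most one letter. -/
theorem truncatedHom_prod_empty (w : Word A) (hw : w.toList.length ≤ L) :
    truncatedHom A L w.prod ⟨empty, by simp [empty]⟩ = ⟨w, hw⟩ := by
  induction w using consRecOn with
  | empty => simp
  | cons i a w h1 h2 ih =>
    have hw' : w.toList.length + 1 ≤ L := by simpa using hw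
    rw [prod_cons, map_mul, Equiv.Perm.mul_apply, ih (by omega), truncatedHom, lift_of]
    exact (truncatedSMul_of_forall _ fun b => (length_of_smul_le b w).trans hw').trans
      (Subtype.ext (cons_eq_smul (h1 := h1) (h2 := h2)).symm)

theorem injOn_truncatedHom_prod :
    Set.InjOn (fun w : Word A => truncatedHom A L w.prod) {w | w.toList.length ≤ L} := by
  intro v hv w hw h
  have := congrArg (fun σ => σ ⟨empty, by simp [empty]⟩) h
  simp only [truncatedHom_prod_empty v hv, truncatedHom_prod_empty w hw] at this
  exact congrArg Subtype.val this

end Truncation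

end Monoid.CoprodI.Word

/-! ### Cayley graphs of quotients -/

namespace Monoid.CoprodI

open Word SimpleGraph

variable {ι : Type*} {A : ι → Type*} [∀ i, Group (A i)] {Γ : Type*} [Group Γ]

theorem Word.fstIdx_empty_ne (i : ι) : (empty : Word A).fstIdx ≠ some i := by
  simp [fstIdx, empty]

theorem Word.prod_cons_empty {i : ι} {a : A i} (ha : a ≠ 1) :
    (cons a empty (fstIdx_empty_ne _) ha).prod = of a := by
  rw [prod_cons, prod_empty, mul_one]

/-- `φ` is injective on the words with at most `k` letters. -/
def InjOnBall (φ : CoprodI A →* Γ) (k : ℕ) : Prop :=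
  Set.InjOn (fun w : Word A => φ w.prod) {w | w.toList.length ≤ k}

theorem InjOnBall.sigma_injective {φ : CoprodI A →* Γ} {k : ℕ} (hφ : InjOnBall φ k) (hk : 1 ≤ k)
    {i j : ι} {a : A i} {b : A j} (ha : a ≠ 1) (hb : b ≠ 1) (h : φ (of a) = φ (of b)) :
    (⟨i, a⟩ : Σ i, A i) = ⟨j, b⟩ := by
  have := @hφ (cons a empty (fstIdx_empty_ne _) ha) (by simpa [empty] using hk)
    (cons b empty (fstIdx_empty_ne _) hb) (by simpa [empty] using hk) (by simpa only [prod_cons_empty] using h)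
  simpa [Word.ext_iff, empty] using this

theorem InjOnBall.map_of_ne_one {φ : CoprodI A →* Γ} {k : ℕ} (hφ : InjOnBall φ k) (hk : 1 ≤ k)
    {i : ι} {a : A i} (ha : a ≠ 1) : φ (of a) ≠ 1 := by
  intro h
  have := @hφ (cons a empty (fstIdx_empty_ne _) ha) (by simpa [empty] using hk)
    empty (by simp [empty])
    (by simpa only [prod_cons_empty, prod_empty, map_one] using h)
  simp [Word.ext_iff, empty] at this

/-- The Cayley graph of `Γ` with respect to the images of the factors of a free product. -/
def cayleyGraph (φ : CoprodI A →* Γ) : SimpleGraph Γ where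
  Adj x y := x ≠ y ∧ ∃ (i : ι) (a : A i), y = φ (of a) * x
  symm.symm := by
    rintro x _ ⟨h, i, a, rfl⟩
    exact ⟨h.symm, i, a⁻¹, by simp⟩
  loopless.irrefl := fun x h => h.1 rfl

theorem exists_of_cayleyGraph_adj {φ : CoprodI A →* Γ} {x y : Γ} (h : (cayleyGraph φ).Adj x y) :
    ∃ (i : ι) (a : A i), a ≠ 1 ∧ y = φ (of a) * x := by
  obtain ⟨hne, i, a, rfl⟩ := h
  exact ⟨i, a, by rintro rfl; simp at hne, rfl⟩

/-- By pigeonhole two leaves are reached through the same factor, hence are adjacent. -/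
theorem not_star_isIndContained_cayleyGraph [Fintype ι] (φ : CoprodI A →* Γ) {t : ℕ}
    (ht : Fintype.card ι < t) :
    ¬ completeBipartiteGraph (Fin 1) (Fin t) ⊴ cayleyGraph φ := by
  rintro ⟨f⟩
  have h : ∀ j : Fin t, (cayleyGraph φ).Adj (f (.inl 0)) (f (.inr j)) := fun j => by simp
  choose _ I a ha using h
  obtain ⟨b, c, hbc, hI⟩ := Fintype.exists_ne_map_eq_of_card_lt I (by simpa using ht)
  have hadj : (cayleyGraph φ).Adj (f (.inr b)) (f (.inr c)) := by
    refine ⟨fun h => hbc (by simpa using f.injective h), ?_⟩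
    obtain ⟨x, hx⟩ : ∃ x : A (I c), f (.inr b) = φ (of x) * f (.inl 0) := hI ▸ ⟨a b, ha b⟩
    exact ⟨I c, a c * x⁻¹, by rw [ha c, hx]; simp⟩
  simp at hadj

theorem mul_le_degree_cayleyGraph [Fintype ι] [Fintype Γ] {φ : CoprodI A →* Γ} {k s : ℕ}
    [DecidableRel (cayleyGraph φ).Adj]
    (hφ : InjOnBall φ k) (hk : 1 ≤ k) [∀ i, Finite (A i)] (hs : ∀ i, Nat.card (A i) = s + 1)
    (x : Γ) : s * Fintype.card ι ≤ (cayleyGraph φ).degree x := by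
  classical
  have := fun i => Fintype.ofFinite (A i)
  have hcard : Fintype.card (Σ i, {a : A i // a ≠ 1}) = s * Fintype.card ι := by
    have : ∀ i, Fintype.card {a : A i // a ≠ 1} = s := fun i => by
      have := hs i
      rw [Nat.card_eq_fintype_card] at this
      simp [Fintype.card_subtype_compl, this]
    simp [Fintype.card_sigma, this, mul_comm]
  rw [← hcard, ← SimpleGraph.card_neighborFinset_eq_degree, ← Finset.card_univ]
  refine Finset.card_le_card_of_injOn (fun a => φ (of a.2.1) * x) ?_ ?_
  · rintro ⟨i, a, ha⟩ -
    rw [Finset.mem_coe, SimpleGraph.mem_neighborFinset]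
    exact ⟨fun h => hφ.map_of_ne_one hk ha (by simpa using h), i, a, rfl⟩
  · rintro ⟨i, a, ha⟩ - ⟨j, b, hb⟩ - h
    have := hφ.sigma_injective hk ha hb (mul_right_cancel h)
    obtain ⟨rfl, h⟩ := Sigma.mk.inj this
    obtain rfl := eq_of_heq h
    rfl

theorem not_cycleGraph_isContained_cayleyGraph {φ : CoprodI A →* Γ} {k : ℕ} (hφ : InjOnBall φ k)
    (hk : 3 ≤ k) [∀ i, Finite (A i)] (hA : ∀ i, Nat.card (A i) < k) :
    ¬ SimpleGraph.cycleGraph k ⊑ cayleyGraph φ := by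
  classical
  rw [SimpleGraph.cycleGraph_isContained_iff (by omega)]
  rintro ⟨x, p, hp, hpk⟩
  have hstep : ∀ j, ∃ f : Word A → Word A, j < k →
      (∀ w, Step w (f w)) ∧ (∀ w, (f w).toList.length ≤ w.toList.length + 1) ∧
      ∀ w : Word A, φ w.prod * x = p.getVert j → φ (f w).prod * x = p.getVert (j + 1) := by
    intro j
    by_cases hj : j < k
    · obtain ⟨i, a, ha, h⟩ := exists_of_cayleyGraph_adj (p.adj_getVert_succ (hpk ▸ hj))
      exact ⟨fun w => of a • w, fun _ => ⟨fun w => ⟨i, a, ha, rfl⟩, length_of_smul_le a,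
        fun w hw => by rw [prod_smul, map_mul, mul_assoc, hw, h]⟩⟩
    · exact ⟨id, fun h => absurd h hj⟩
  choose f hf using hstep
  let W : ℕ → Word A := fun j => Nat.rec empty f j
  have hW : ∀ j ≤ k, (W j).toList.length ≤ j ∧ φ (W j).prod * x = p.getVert j := by
    intro j
    induction j with
    | zero => exact fun _ => by simp [W, empty, prod]
    | succ j ih =>
      intro hj
      obtain ⟨hl, hv⟩ := ih (by omega)
      exact ⟨((hf j hj).2.1 (W j)).trans (by omega), (hf j hj).2.2 (W j) hv⟩
  -- The lift closes up: `W k` has at most `k` letters and the same image as `empty`.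
  have hWk : W k = empty := by
    refine hφ (hW k le_rfl).1 (by simp [empty]) ?_
    have := (hW k le_rfl).2
    rw [← hpk, p.getVert_length] at this
    simpa [hpk] using this
  obtain ⟨i, hi⟩ := exists_le_card_of_steps (by omega) rfl hWk (fun a ha b hb hab => by
    refine hp.getVert_injOn' (by simp; omega) (by simp; omega) ?_
    rw [← (hW a ha.le).2, ← (hW b hb.le).2, hab]) fun j hj => (hf j hj).1 (W j)
  exact absurd hi (hA i).not_ge

end Monoid.CoprodI

/-! ### Both bounds for the induced Turán number -/

namespace SimpleGraph

theorem card_edgeFinset_le_inducedTuranNumber {U V W : Type*} [Fintype U] {G : SimpleGraph U}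
    [Fintype G.edgeSet] {H : SimpleGraph V} {F : SimpleGraph W} (hH : ¬ H ⊑ G) (hF : ¬ F ⊴ G) :
    G.edgeFinset.card ≤ inducedTuranNumber (Fintype.card U) H F := by
  classical
  let e := G.overFinIso rfl
  rw [e.card_edgeFinset_eq]
  have hmem : ¬ H ⊑ G.overFin rfl ∧ ¬ F ⊴ G.overFin rfl :=
    ⟨fun h => hH (h.trans e.isContained'), fun h => hF (h.trans e.isIndContained')⟩
  unfold inducedTuranNumber
  refine le_trans (le_of_eq ?_) (Finset.le_sup (b := G.overFin rfl)
    (Finset.mem_filter.2 ⟨Finset.mem_univ _, hmem⟩))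
  congr!

theorem two_mul_inducedTuranNumber_cycleGraph_star_le {t k : ℕ} (ht : 3 ≤ t) (hk : 3 ≤ k)
    (n : ℕ) :
    2 * inducedTuranNumber n (cycleGraph k) (completeBipartiteGraph (Fin 1) (Fin t))
      ≤ (k - 2) * (t - 1) * n := by
  classical
  rw [mul_comm 2, ← Nat.le_div_iff_mul_le two_pos]
  refine Finset.sup_le fun G hG => ?_
  rw [Finset.mem_filter] at hG
  rw [Nat.le_div_iff_mul_le two_pos, mul_comm]
  simpa using two_mul_card_edgeFinset_le_of_free ht hk hG.2.1 hG.2.2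

/-- There are arbitrarily large `n` attaining the bound: take the Cayley graph of a finite quotient
of a free product of `t - 1` cyclic groups of order `k - 1`. -/
theorem exists_two_mul_inducedTuranNumber_cycleGraph_star_ge {t k : ℕ} (ht : 3 ≤ t) (hk : 3 ≤ k)
    (N : ℕ) : ∃ n > N, (k - 2) * (t - 1) * n ≤
      2 * inducedTuranNumber n (cycleGraph k) (completeBipartiteGraph (Fin 1) (Fin t)) := by
  classical
  have : NeZero (k - 1) := ⟨by omega⟩
  let A : Fin (t - 1) → Type := fun _ => Multiplicative (ZMod (k - 1))
  have hA : ∀ i, Nat.card (A i) = k - 1 := fun i => Nat.card_zmod (k - 1)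
  have hfin : ∀ i, Finite (A i) := fun i => Nat.finite_of_card_ne_zero (by rw [hA i]; omega)
  let Γ := Equiv.Perm (Monoid.CoprodI.Word.Ball A k) × Multiplicative (ZMod (N + 1))
  have := Fintype.ofFinite Γ
  -- The trivial second component yields `N + 1` disjoint copies of the graph, making `n` exceed
  -- `N`.
  let φ : Monoid.CoprodI A →* Γ := (Monoid.CoprodI.Word.truncatedHom A k).prod 1
  have hφ : Monoid.CoprodI.InjOnBall φ k := fun v hv w hw h =>
    Monoid.CoprodI.Word.injOn_truncatedHom_prod hv hw (congrArg Prod.fst h)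
  have hC := Monoid.CoprodI.not_cycleGraph_isContained_cayleyGraph hφ hk
    fun i => by rw [hA i]; omega
  have hK := Monoid.CoprodI.not_star_isIndContained_cayleyGraph φ (t := t) (by simp; omega)
  refine ⟨Fintype.card Γ, ?_, ?_⟩
  · rw [← Nat.card_eq_fintype_card, Nat.card_prod]
    have : Nat.card (Multiplicative (ZMod (N + 1))) = N + 1 := Nat.card_zmod (N + 1)
    rw [this]
    have := Nat.card_pos (α := Equiv.Perm (Monoid.CoprodI.Word.Ball A k))
    nlinarith
  · refine le_trans ?_ (Nat.mul_le_mul_left 2 (card_edgeFinset_le_inducedTuranNumber hC hK))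
    rw [← sum_degrees_eq_twice_card_edges, mul_comm _ (Fintype.card Γ)]
    refine Finset.card_nsmul_le_sum _ _ _ fun x _ => ?_
    have := Monoid.CoprodI.mul_le_degree_cayleyGraph hφ (by omega) (s := k - 2)
      (fun i => by rw [hA i]; omega) x
    rwa [Fintype.card_fin] at this

end SimpleGraph

theorem theorem2 (t k : ℕ) (ht : 3 ≤ t) (hk : 3 ≤ k) :
    (∀ n : ℕ,
      (SimpleGraph.inducedTuranNumber n (SimpleGraph.cycleGraph k)
          (completeBipartiteGraph (Fin 1) (Fin t)) : ℝ)
        ≤ ((k : ℝ) - 2) * ((t : ℝ) - 1) * (n : ℝ) / 2) ∧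
    {n : ℕ |
      (SimpleGraph.inducedTuranNumber n (SimpleGraph.cycleGraph k)
          (completeBipartiteGraph (Fin 1) (Fin t)) : ℝ)
        = ((k : ℝ) - 2) * ((t : ℝ) - 1) * (n : ℝ) / 2}.Infinite := by
  have hcast : ∀ n : ℕ, (((k - 2) * (t - 1) * n : ℕ) : ℝ) = ((k : ℝ) - 2) * ((t : ℝ) - 1) * n :=
    fun n => by
      push_cast [Nat.cast_sub (show 2 ≤ k by omega), Nat.cast_sub (show 1 ≤ t by omega)]
      rfl
  have hle : ∀ n : ℕ,
      (SimpleGraph.inducedTuranNumber n (SimpleGraph.cycleGraph k)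
          (completeBipartiteGraph (Fin 1) (Fin t)) : ℝ)
        ≤ ((k : ℝ) - 2) * ((t : ℝ) - 1) * (n : ℝ) / 2 := fun n => by
    have := SimpleGraph.two_mul_inducedTuranNumber_cycleGraph_star_le ht hk n
    rw [← hcast, le_div_iff₀ two_pos, mul_comm]
    exact_mod_cast this
  refine ⟨hle, Set.infinite_of_forall_exists_gt fun N => ?_⟩
  obtain ⟨n, hn, h⟩ := SimpleGraph.exists_two_mul_inducedTuranNumber_cycleGraph_star_ge ht hk N
  refine ⟨n, le_antisymm (hle n) ?_, hn⟩
  rw [← hcast, div_le_iff₀ two_pos, mul_comm (_ : ℝ) 2]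
  exact_mod_cast h
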